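/- Let $G=(V,E)$ be a finite simple graph on $n=|V|$ vertices with degrees $d_v$, and let $0\le p\le 1$. For a set of edges $F\subseteq E$ let $|F\rangle=\prod_{\{i,j\}\in F}\mathrm{CZ}_{ij}\,|+\rangle^{\otimes n}$ be the graph state of the spanning subgraph $(V,F)$, and write $|G\rangle=|E\rangle$. The randomized graph state, the randomization overlap and their truncations are $$\rho_G^p=\sum_{F\subseteq E}p^{|F|}(1-p)^{|E\setminus F|}|F\rangle\langle F|,\qquad L(\rho_G^p)=\mathrm{Tr}\big[|G\rangle\langle G|\,\rho_G^p\big],$$ $$L_{\le 2}(\rho_G^p)=\sum_{F\subseteq E,\ |F\Delta E|\le 2}p^{|F|}(1-p)^{|E\setminus F|}\,\mathrm{Tr}\big[|G\rangle\langle G|F\rangle\langle F|\big].$$ Put $W_G=\tfrac12\mathbb 1-|G\rangle\langle G|$, $I_w(p)=\mathrm{Tr}[W_G\rho_G^p]$ and $I_{\le2}(p)=\tfrac12-L_{\le2}(\rho_G^p)$. A state is called genuinely multipartite entangled (GME) if it is not a convex combination of states each of which is separable with respect to some bipartition of $V$ into two nonempty parts. Let $p_c$ (respectively $p_w$) be the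 least $t\in[0,1]$ such that for all $p\in(t,1]$ the state $\rho_G^p$ is GME (respectively $I_w(p)<0$). 1. For all $p\in[0,1]$, $$L(\rho_G^p)\ \ge\ L_{\le2}(\rho_G^p)=p^{|E|}+\tfrac14(1-p)p^{|E|-1}|E|+\tfrac1{16}(1-p)^2p^{|E|-2}\Big[\tbinom{|E|}{2}+3\sum_{v\in V}\tbinom{d_v}{2}\Big]$$ (a term whose coefficient $|E|$ or $[\cdots]$ is zero being read as $0$, and $0^0=1$), and consequently $I_w(p)\le I_{\le2}(p)$. Moreover $L(\rho_G^p)-L_{\le2}(\rho_G^p)=O((1-p)^3)$ as $p\to1$ in $[0,1]$. 2. If $G$ is connected, $p\in[0,1]$ and $I_{\le2}(p)<0$, then $\rho_G^p$ is genuinely multipartite entangled. 3. If $E\neq\emptyset$, then $I_{\le2}$ has exactly one zero $p_{\mathcal F}$ in $[0,1]$, one has $I_{\le2}(p)<0$ for all $p\in(p_{\mathcal F},1]$, $p_w\le p_{\mathcal F}$, and every zero of $I_w$ in $[0,1]$ is at most $p_{\mathcal F}$. If in addition $G$ is connected, then $p_c\le p_w\le p_{\mathcal F}$, and $\rho_G^p$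 is GME for every $p\in(p_{\mathcal F},1]$. -/

import Mathlib

/-!
Qubits are labelled by a finite type `V`; the computational basis of the `|V|`-qubit space is
indexed by the bit strings `V → Fin 2`, a vector is a function `(V → Fin 2) → ℂ` and an operator
is a matrix over `V → Fin 2`.
-/

namespace RandomizedGraph

open scoped Matrix ComplexOrder

noncomputable section

/-! ### Graph states -/

section GraphStates

variable {V : Type*} [Fintype V] [DecidableEq V]

/-- The diagonal entries of the controlled-`Z` gate acting on the two end points of `e`:
`-1` on the bit strings that are `1` at both end points, and `1` on the others. -/
def czSign (e : Sym2 V) (x : V → Fin 2) : ℂ :=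
  if ∀ v ∈ e, x v = 1 then -1 else 1

/-- The controlled-`Z` gate on the two end points of `e`. -/
def cz (e : Sym2 V) : Matrix (V → Fin 2) (V → Fin 2) ℂ :=
  Matrix.diagonal (czSign e)

theorem cz_commute (e f : Sym2 V) : Commute (cz e) (cz f) := by
  simp only [Commute, SemiconjBy, cz, Matrix.diagonal_mul_diagonal, mul_comm]

theorem cz_pairwise (E : Finset (Sym2 V)) :
    (E : Set (Sym2 V)).Pairwise (Function.onFun Commute cz) :=
  fun e _ f _ _ => cz_commute e f

/-- The state `|+⟩^{⊗ n}`. -/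
def plusState (V : Type*) [Fintype V] : (V → Fin 2) → ℂ :=
  fun _ => ∏ _v : V, ((1 / Real.sqrt 2 : ℝ) : ℂ)

/-- The graph state of the graph with vertex set `V` and edge set `E`: apply a controlled-`Z`
gate along every edge to `|+⟩^{⊗ n}`. -/
def graphState (E : Finset (Sym2 V)) : (V → Fin 2) → ℂ :=
  (E.noncommProd cz (cz_pairwise E)) *ᵥ plusState V

theorem graphState_apply (E : Finset (Sym2 V)) (x : V → Fin 2) :
    graphState E x = (∏ e ∈ E, czSign e x) * ((1 / Real.sqrt 2 : ℝ) : ℂ) ^ Fintype.card V := by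
  have h : E.noncommProd cz (cz_pairwise E)
      = Matrix.diagonal (fun x : V → Fin 2 => ∏ e ∈ E, czSign e x) := by
    induction E using Finset.induction_on with
    | empty => rw [Finset.noncommProd_empty]; simp
    | insert a s ha ih =>
      rw [Finset.noncommProd_insert_of_notMem _ _ _ _ ha, ih]
      simp only [cz, Matrix.diagonal_mul_diagonal, Finset.prod_insert ha]
  rw [graphState, h, Matrix.mulVec_diagonal]
  simp [plusState]

/-- The rank-one operator `|ψ⟩⟨ψ|`. -/
def ketBra {ι : Type*} (ψ : ι → ℂ) : Matrix ι ι ℂ :=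
  Matrix.vecMulVec ψ (star ψ)

variable (G : SimpleGraph V) [DecidableRel G.Adj]

/-- The `p`-randomization of the graph state of `G`. A spanning subgraph of `G` is given by its
edge set, an arbitrary subset of the edge set of `G`. -/
def rgState (p : ℝ) : Matrix (V → Fin 2) (V → Fin 2) ℂ :=
  ∑ F ∈ G.edgeFinset.powerset,
    (p ^ F.card * (1 - p) ^ (G.edgeFinset \ F).card) • ketBra (graphState F)

/-- The part of the `p`-randomization that comes from the spanning subgraphs differing from `G`
in at most `l` edges. -/
def rgStateTrunc (l : ℕ) (p : ℝ) : Matrix (V → Fin 2) (V → Fin 2) ℂ :=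
  ∑ F ∈ G.edgeFinset.powerset with (symmDiff F G.edgeFinset).card ≤ l,
    (p ^ F.card * (1 - p) ^ (G.edgeFinset \ F).card) • ketBra (graphState F)

/-- The randomization overlap `Tr[|G⟩⟨G| ρ]`. The trace is real, both factors being Hermitian;
`re` only makes it an element of `ℝ`. -/
def overlap (p : ℝ) : ℝ :=
  (Matrix.trace (ketBra (graphState G.edgeFinset) * rgState G p)).re

/-- The `l`-level approximated randomization overlap. -/
def overlapTrunc (l : ℕ) (p : ℝ) : ℝ :=
  (Matrix.trace (ketBra (graphState G.edgeFinset) * rgStateTrunc G l p)).re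

/-- The projector-based witness `1/2 - |G⟩⟨G|`. -/
def projWitness : Matrix (V → Fin 2) (V → Fin 2) ℂ :=
  (1 / 2 : ℝ) • (1 : Matrix (V → Fin 2) (V → Fin 2) ℂ) - ketBra (graphState G.edgeFinset)

/-- The expectation value of the projector-based witness in the `p`-randomization of `G`. -/
def witnessValue (p : ℝ) : ℝ :=
  (Matrix.trace (projWitness G * rgState G p)).re

/-- The `l`-level approximated witness. -/
def witnessTrunc (l : ℕ) (p : ℝ) : ℝ :=
  1 / 2 - overlapTrunc G l p

end GraphStates

/-! ### Genuine multipartite entanglement -/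

section Entanglement

/-- Density matrices: positive semidefinite of trace one. -/
def IsDensity {ι : Type*} [Fintype ι] (ρ : Matrix ι ι ℂ) : Prop :=
  ρ.PosSemidef ∧ ρ.trace = 1

variable {V : Type*} [Fintype V] [DecidableEq V]

/-- `ρ = α ⊗ β` with a state `α` of the qubits in `A` and a state `β` of the other qubits. -/
def IsProductAcross (A : Finset V) (ρ : Matrix (V → Fin 2) (V → Fin 2) ℂ) : Prop :=
  ∃ (α : Matrix ({v // v ∈ A} → Fin 2) ({v // v ∈ A} → Fin 2) ℂ)
    (β : Matrix ({v // v ∉ A} → Fin 2) ({v // v ∉ A} → Fin 2) ℂ),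
    IsDensity α ∧ IsDensity β ∧
      ∀ x y, ρ x y = α (fun v => x v) (fun v => y v) * β (fun v => x v) (fun v => y v)

/-- Separability with respect to the bipartition `A | Aᶜ`. -/
def IsSeparableAcross (A : Finset V) (ρ : Matrix (V → Fin 2) (V → Fin 2) ℂ) : Prop :=
  ρ ∈ convexHull ℝ {σ | IsProductAcross A σ}

/-- A state is genuinely multipartite entangled if it is not a convex combination of states each
of which is separable with respect to some bipartition into two nonempty parts. -/
def IsGME (ρ : Matrix (V → Fin 2) (V → Fin 2) ℂ) : Prop :=
  IsDensity ρ ∧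
    ρ ∉ convexHull ℝ {σ | ∃ A : Finset V, A.Nonempty ∧ Aᶜ.Nonempty ∧ IsSeparableAcross A σ}

end Entanglement

/-! ### Thresholds -/

section Thresholds

/-- The least `t ∈ [0,1]` such that `P p` holds for all `p` with `t < p ≤ 1`. -/
def threshold (P : ℝ → Prop) : ℝ :=
  sInf {t | t ∈ Set.Icc (0 : ℝ) 1 ∧ ∀ p ∈ Set.Ioc t 1, P p}

variable {V : Type*} [Fintype V] [DecidableEq V] (G : SimpleGraph V) [DecidableRel G.Adj]

/-- The critical randomness above which the randomized graph state is genuinely multipartite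
entangled. -/
def criticalP : ℝ := threshold fun p => IsGME (rgState G p)

/-- The randomness above which the projector-based witness has a negative expectation value. -/
def witnessP : ℝ := threshold fun p => witnessValue G p < 0

end Thresholds

end

end RandomizedGraph

namespace RandomizedGraph

open scoped Matrix ComplexOrder

noncomputable section

/-! ### Overlap amplitudes and the closed form of the second-order overlap -/

section Overlaps

variable {V : Type*} [Fintype V] [DecidableEq V]

/-! Graph-state amplitudes are real, of modulus `2 ^ (-n/2)`, and signs of common edges cancel. So
the overlap of `E` with `F ⊆ E` depends only on the removed set `D = E \ F`: it is the mean
`signMean D` of a product of signs. Hence the randomization overlap is a sum over `D` of `p ^ (m -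
|D|) * (1 - p) ^ |D| * signMean D ^ 2`, with `m = |E|`. On `[0,1]` all terms are nonnegative, so
truncation gives a lower bound, and the omitted terms carry `(1 - p) ^ 3`. The squared mean is `1/4`
for one edge, `1/4` for two edges sharing a vertex and `1/16` for two disjoint edges; `∑ v, (d_v
choose 2)` counts the sharing pairs.

If `G` is connected, every bipartition is cut by an edge `ab`. Fixing the bits on the side of `b`
slices the graph state; slices differing only at `b` are orthogonal (`slice_orthogonal`). Bounding
`α ⊗ β` by `α ⊗ 1` and applying Bessel to such pairs bounds the fidelity of a product state by
`1/2`; by convexity, an overlap above `1/2` certifies GME.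

Finally, the pair coefficient is at most `(m choose 2) / 4`, which makes the second-order overlap
strictly increasing (`strictMonoOn_secondOrder`). It runs from at most `1/4` to `1`, so it crosses
`1/2` exactly once. -/

/-- The real number underlying `czSign`. -/
def czSignReal (e : Sym2 V) (x : V → Fin 2) : ℝ :=
  if ∀ v ∈ e, x v = 1 then -1 else 1

theorem czSign_eq_ofReal (e : Sym2 V) (x : V → Fin 2) :
    czSign e x = (czSignReal e x : ℂ) := by
  unfold czSign czSignReal
  split_ifs <;> simp

theorem czSignReal_mk (a b : V) (x : V → Fin 2) :
    czSignReal s(a, b) x = if x a = 1 ∧ x b = 1 then -1 else 1 := by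
  simp [czSignReal]

theorem czSignReal_mul_self (e : Sym2 V) (x : V → Fin 2) :
    czSignReal e x * czSignReal e x = 1 := by
  unfold czSignReal
  split_ifs <;> norm_num

theorem prod_czSignReal_mul_self (D : Finset (Sym2 V)) (x : V → Fin 2) :
    (∏ e ∈ D, czSignReal e x) * (∏ e ∈ D, czSignReal e x) = 1 := by
  rw [← Finset.prod_mul_distrib]
  exact Finset.prod_eq_one fun e _ => czSignReal_mul_self e x

theorem graphState_eq_ofReal (E : Finset (Sym2 V)) (x : V → Fin 2) :
    graphState E x =
      (((∏ e ∈ E, czSignReal e x) * (1 / Real.sqrt 2) ^ Fintype.card V : ℝ) : ℂ) := by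
  rw [graphState_apply]
  push_cast
  simp only [czSign_eq_ofReal]

theorem star_graphState (E : Finset (Sym2 V)) : star (graphState E) = graphState E := by
  funext x
  rw [Pi.star_apply, graphState_eq_ofReal]
  exact Complex.conj_ofReal _

theorem inv_sqrt_two_pow_mul_self (n : ℕ) :
    (1 / Real.sqrt 2) ^ n * (1 / Real.sqrt 2) ^ n = 1 / 2 ^ n := by
  rw [← mul_pow, div_mul_div_comm, Real.mul_self_sqrt (by norm_num), one_mul, one_div_pow]

/-- Flip the bit at `v`. -/
def flipBit {W : Type*} [DecidableEq W] (v : W) (x : W → Fin 2) : W → Fin 2 :=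
  Function.update x v (x v + 1)

theorem flipBit_involutive {W : Type*} [DecidableEq W] (v : W) :
    Function.Involutive (flipBit v) := by
  intro x
  have : x v + 1 + 1 = x v := by
    generalize x v = j
    fin_cases j <;> rfl
  simp [flipBit, this]

theorem sum_flipBit {W M : Type*} [Fintype W] [DecidableEq W] [AddCommMonoid M] (v : W)
    (f : (W → Fin 2) → M) : ∑ x, f (flipBit v x) = ∑ x, f x :=
  Equiv.sum_comp (flipBit_involutive v).toPerm f

/-- The mean over all bit strings. -/
def bitMean (f : (V → Fin 2) → ℝ) : ℝ :=
  (∑ x, f x) / 2 ^ Fintype.card V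

theorem bitMean_const (c : ℝ) : bitMean (fun _ : V → Fin 2 => c) = c := by
  simp [bitMean]

/-- Averaging over one coordinate does not change the mean. -/
theorem bitMean_update (v : V) (f : (V → Fin 2) → ℝ) :
    bitMean f =
      bitMean fun x => (f (Function.update x v 0) + f (Function.update x v 1)) / 2 := by
  have key : ∀ x : V → Fin 2, f (Function.update x v 0) + f (Function.update x v 1)
      = f x + f (flipBit v x) := by
    intro x
    rw [flipBit]
    have h : x v = 0 ∨ x v = 1 := by
      generalize x v = j
      fin_cases j <;> simp
    rcases h with h | h
    · nth_rewrite 1 [← h]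
      rw [Function.update_eq_self, h, zero_add]
    · have h0 : x v + 1 = 0 := by rw [h]; rfl
      have h1 : Function.update x v 1 = x := by rw [← h, Function.update_eq_self]
      rw [h0, h1, add_comm]
  unfold bitMean
  simp only [key]
  rw [← Finset.sum_div, Finset.sum_add_distrib, sum_flipBit]
  ring

/-- The overlap amplitude of two graph states whose edge sets differ by `D`. -/
def signMean (D : Finset (Sym2 V)) : ℝ :=
  bitMean fun x => ∏ e ∈ D, czSignReal e x

theorem signMean_empty : signMean (∅ : Finset (Sym2 V)) = 1 := by
  simp [signMean, bitMean_const]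

theorem bitMean_eq_zero (v : V) :
    bitMean (fun x => if x v = 0 then 1 else 0) = 1 / 2 := by
  rw [bitMean_update v]
  simp [bitMean_const]

/-- Averaging over the bit at `a` cancels the sign where `x b = 1` and leaves `1` where `x b = 0`.
-/
theorem signMean_singleton {a b : V} (h : a ≠ b) :
    signMean ({s(a, b)} : Finset (Sym2 V)) = 1 / 2 := by
  simp only [signMean, Finset.prod_singleton, czSignReal_mk]
  rw [bitMean_update a, ← bitMean_eq_zero b]
  congr 1
  funext x
  generalize hj : x b = j
  fin_cases j <;> simp [h.symm, hj]

/-- Averaging over the leaf `b` leaves the indicator of `x a = 0`, on which the second sign is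
already `1`. -/
theorem signMean_pair_adjacent {a b c : V} (hab : a ≠ b) (hac : a ≠ c) (hbc : b ≠ c) :
    signMean ({s(a, b), s(a, c)} : Finset (Sym2 V)) = 1 / 2 := by
  have hne : s(a, b) ≠ s(a, c) := by simp [hbc, hac]
  simp only [signMean, Finset.prod_pair hne, czSignReal_mk]
  rw [bitMean_update b, ← bitMean_eq_zero a]
  congr 1
  funext x
  generalize hj : x a = j
  fin_cases j
  · simp [hab, hbc.symm, hj]
  · by_cases hc : x c = 1 <;> simp [hab, hbc.symm, hj, hc]

/-- Disjoint edges involve independent bits: averaging over `a`, then `b`, extracts a factor `1/2`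
and leaves the mean of the other edge. -/
theorem signMean_pair_disjoint {a b c d : V} (hab : a ≠ b) (hcd : c ≠ d) (hac : a ≠ c)
    (had : a ≠ d) (hbc : b ≠ c) (hbd : b ≠ d) :
    signMean ({s(a, b), s(c, d)} : Finset (Sym2 V)) = 1 / 4 := by
  have hne : s(a, b) ≠ s(c, d) := by simp [hac, had]
  simp only [signMean, Finset.prod_pair hne, czSignReal_mk]
  have h₁ : bitMean (fun x : V → Fin 2 =>
      (if x a = 1 ∧ x b = 1 then -1 else 1) * (if x c = 1 ∧ x d = 1 then -1 else 1))
      = bitMean fun x : V → Fin 2 =>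
        (if x b = 0 then 1 else 0) * (if x c = 1 ∧ x d = 1 then -1 else 1) := by
    rw [bitMean_update a]
    congr 1
    funext x
    generalize hj : x b = j
    fin_cases j
    · simp [hab.symm, hac.symm, had.symm, hj]
    · by_cases hc : x c = 1 ∧ x d = 1 <;> simp [hab.symm, hac.symm, had.symm, hj, hc]
  have h₂ : bitMean (fun x : V → Fin 2 =>
      (if x b = 0 then 1 else 0) * (if x c = 1 ∧ x d = 1 then -1 else 1))
      = bitMean fun x : V → Fin 2 => (if x c = 1 ∧ x d = 1 then -1 else 1) / 2 := by
    rw [bitMean_update b]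
    simp [hbc.symm, hbd.symm]
  have h₃ := signMean_singleton hcd
  simp only [signMean, Finset.prod_singleton, czSignReal_mk] at h₃
  rw [h₁, h₂]
  unfold bitMean at h₃ ⊢
  rw [← Finset.sum_div, div_right_comm, h₃]
  norm_num

theorem trace_ketBra_mul_ketBra {ι : Type*} [Fintype ι] (ψ φ : ι → ℂ) :
    Matrix.trace (ketBra ψ * ketBra φ) = (star ψ ⬝ᵥ φ) * (star φ ⬝ᵥ ψ) := by
  rw [ketBra, ketBra, Matrix.vecMulVec_mul_vecMulVec, Matrix.trace_vecMulVec,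
    dotProduct_smul, smul_eq_mul, dotProduct_comm ψ]

theorem dotProduct_graphState {E F : Finset (Sym2 V)} (h : F ⊆ E) :
    star (graphState E) ⬝ᵥ graphState F = (signMean (E \ F) : ℂ) := by
  rw [star_graphState, dotProduct]
  simp only [graphState_eq_ofReal]
  norm_cast
  rw [signMean, bitMean, Finset.sum_div]
  refine Finset.sum_congr rfl fun x _ => ?_
  rw [← Finset.prod_sdiff h, mul_mul_mul_comm, inv_sqrt_two_pow_mul_self,
    mul_assoc (∏ e ∈ E \ F, _),
    prod_czSignReal_mul_self]
  ring

theorem trace_ketBra_graphState {E F : Finset (Sym2 V)} (h : F ⊆ E) :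
    Matrix.trace (ketBra (graphState E) * ketBra (graphState F))
      = ((signMean (E \ F) ^ 2 : ℝ) : ℂ) := by
  have h' : star (graphState F) ⬝ᵥ graphState E = star (graphState E) ⬝ᵥ graphState F := by
    rw [star_graphState, star_graphState, dotProduct_comm]
  rw [trace_ketBra_mul_ketBra, h', dotProduct_graphState h]
  push_cast
  ring

theorem trace_ketBra_graphState_self (E : Finset (Sym2 V)) :
    Matrix.trace (ketBra (graphState E)) = 1 := by
  rw [ketBra, Matrix.trace_vecMulVec, dotProduct_comm, dotProduct_graphState subset_rfl]
  simp [signMean_empty]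

/-! ### Expansion of the overlap by removed edge sets -/

variable (G : SimpleGraph V) [DecidableRel G.Adj]

theorem overlap_eq_sum (p : ℝ) :
    overlap G p = ∑ D ∈ G.edgeFinset.powerset,
      p ^ (G.edgeFinset.card - D.card) * (1 - p) ^ D.card * signMean D ^ 2 := by
  rw [overlap, rgState, Finset.mul_sum, Matrix.trace_sum, Complex.re_sum]
  refine Finset.sum_nbij' (fun F => G.edgeFinset \ F) (fun F => G.edgeFinset \ F)
    ?_ ?_ ?_ ?_ ?_
  · intro F _
    simp
  · intro F _
    simp
  · intro F hF
    exact Finset.sdiff_sdiff_eq_self (Finset.mem_powerset.mp hF)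
  · intro F hF
    exact Finset.sdiff_sdiff_eq_self (Finset.mem_powerset.mp hF)
  · intro F hF
    have hF' := Finset.mem_powerset.mp hF
    rw [Matrix.mul_smul, Matrix.trace_smul, trace_ketBra_graphState hF', Complex.real_smul,
      ← Complex.ofReal_mul, Complex.ofReal_re, Finset.card_sdiff_of_subset hF',
      Nat.sub_sub_self (Finset.card_le_card hF')]

theorem overlapTrunc_eq_sum (l : ℕ) (p : ℝ) :
    overlapTrunc G l p = ∑ D ∈ G.edgeFinset.powerset with D.card ≤ l,
      p ^ (G.edgeFinset.card - D.card) * (1 - p) ^ D.card * signMean D ^ 2 := by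
  rw [overlapTrunc, rgStateTrunc, Finset.mul_sum, Matrix.trace_sum, Complex.re_sum]
  have hsd : ∀ F ∈ G.edgeFinset.powerset, symmDiff F G.edgeFinset = G.edgeFinset \ F := by
    intro F hF
    exact symmDiff_of_le (Finset.mem_powerset.mp hF)
  refine Finset.sum_nbij' (fun F => G.edgeFinset \ F) (fun F => G.edgeFinset \ F)
    ?_ ?_ ?_ ?_ ?_
  · intro F hF
    rw [Finset.mem_filter] at hF ⊢
    rw [hsd F hF.1] at hF
    exact ⟨by simp, hF.2⟩
  · intro F hF
    rw [Finset.mem_filter] at hF ⊢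
    have hm : G.edgeFinset \ F ∈ G.edgeFinset.powerset := by simp
    rw [hsd _ hm, Finset.sdiff_sdiff_eq_self (Finset.mem_powerset.mp hF.1)]
    exact ⟨hm, hF.2⟩
  · intro F hF
    exact Finset.sdiff_sdiff_eq_self (Finset.mem_powerset.mp (Finset.mem_filter.mp hF).1)
  · intro F hF
    exact Finset.sdiff_sdiff_eq_self (Finset.mem_powerset.mp (Finset.mem_filter.mp hF).1)
  · intro F hF
    have hF' := Finset.mem_powerset.mp (Finset.mem_filter.mp hF).1
    rw [Matrix.mul_smul, Matrix.trace_smul, trace_ketBra_graphState hF', Complex.real_smul,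
      ← Complex.ofReal_mul, Complex.ofReal_re, Finset.card_sdiff_of_subset hF',
      Nat.sub_sub_self (Finset.card_le_card hF')]

theorem overlap_sub_overlapTrunc (l : ℕ) (p : ℝ) :
    overlap G p - overlapTrunc G l p = ∑ D ∈ G.edgeFinset.powerset with ¬ D.card ≤ l,
      p ^ (G.edgeFinset.card - D.card) * (1 - p) ^ D.card * signMean D ^ 2 := by
  rw [overlap_eq_sum, overlapTrunc_eq_sum, sub_eq_iff_eq_add, add_comm,
    Finset.sum_filter_add_sum_filter_not]

theorem overlapTrunc_le_overlap (l : ℕ) {p : ℝ} (hp : p ∈ Set.Icc (0 : ℝ) 1) :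
    overlapTrunc G l p ≤ overlap G p := by
  rw [← sub_nonneg, overlap_sub_overlapTrunc]
  refine Finset.sum_nonneg fun D _ => ?_
  have h₁ := hp.1
  have h₂ : 0 ≤ 1 - p := sub_nonneg.mpr hp.2
  positivity

theorem overlap_sub_overlapTrunc_isBigO (l : ℕ) :
    (fun p => overlap G p - overlapTrunc G l p)
      =O[nhdsWithin 1 (Set.Icc (0 : ℝ) 1)] (fun p => (1 - p) ^ (l + 1)) := by
  simp only [overlap_sub_overlapTrunc]
  refine Asymptotics.IsBigO.fun_sum fun D hD => ?_
  have hl : l + 1 ≤ D.card := by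
    have := (Finset.mem_filter.mp hD).2
    omega
  refine Asymptotics.IsBigO.of_bound (signMean D ^ 2) ?_
  filter_upwards [self_mem_nhdsWithin] with p hp
  have h₁ := hp.1
  have h₂ : 0 ≤ 1 - p := sub_nonneg.mpr hp.2
  rw [Real.norm_of_nonneg (by positivity), Real.norm_of_nonneg (by positivity), mul_comm]
  refine mul_le_mul_of_nonneg_left ?_ (by positivity)
  calc p ^ (G.edgeFinset.card - D.card) * (1 - p) ^ D.card
      ≤ 1 * (1 - p) ^ (l + 1) :=
        mul_le_mul (pow_le_one₀ h₁ hp.2) (pow_le_pow_of_le_one h₂ (by linarith) hl)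
          (by positivity) zero_le_one
    _ = (1 - p) ^ (l + 1) := one_mul _

/-- The squared amplitude of a pair of edges in terms of the number of common end points. -/
theorem signMean_sq_of_mem_powersetCard_two {D : Finset (Sym2 V)}
    (hD : D ∈ G.edgeFinset.powersetCard 2) :
    signMean D ^ 2
        = 1 / 16 + 3 / 16 * ((Finset.univ.filter fun v => D ⊆ G.incidenceFinset v).card : ℝ)
      ∧ signMean D ^ 2 ≤ 1 / 4 := by
  rw [Finset.mem_powersetCard, Finset.card_eq_two] at hD
  obtain ⟨hDE, e, f, hef, rfl⟩ := hD
  have he : e ∈ G.edgeFinset := hDE (by simp)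
  have hf : f ∈ G.edgeFinset := hDE (by simp)
  rw [SimpleGraph.mem_edgeFinset] at he hf
  have hinc : ∀ v, ({e, f} : Finset (Sym2 V)) ⊆ G.incidenceFinset v ↔ v ∈ e ∧ v ∈ f := by
    intro v
    simp [Finset.insert_subset_iff, SimpleGraph.incidenceSet, he, hf]
  simp only [hinc]
  -- Distinct edges share at most one vertex, so the count is `1` or `0`, giving `1/16 + 3/16 =
  -- (1/2)^2` or `1/16 = (1/4)^2`.
  by_cases hv : ∃ a, a ∈ e ∧ a ∈ f
  · obtain ⟨a, hae, haf⟩ := hv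
    obtain ⟨b, rfl⟩ := Sym2.mem_iff_exists.mp hae
    obtain ⟨c, rfl⟩ := Sym2.mem_iff_exists.mp haf
    have hab : a ≠ b := G.ne_of_adj he
    have hac : a ≠ c := G.ne_of_adj hf
    have hbc : b ≠ c := fun h => hef (by rw [h])
    have hcard : (Finset.univ.filter fun v => v ∈ s(a, b) ∧ v ∈ s(a, c)) = {a} := by
      ext v
      simp only [Finset.mem_filter, Finset.mem_univ, true_and, Sym2.mem_iff,
        Finset.mem_singleton]
      grind
    rw [signMean_pair_adjacent hab hac hbc, hcard]
    norm_num
  · have hcard : (Finset.univ.filter fun v => v ∈ e ∧ v ∈ f) = ∅ := by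
      ext v
      simpa using fun h h' => hv ⟨v, h, h'⟩
    rw [hcard]
    induction e with | _ a b
    induction f with | _ c d
    simp only [Sym2.mem_iff, not_exists] at hv
    rw [signMean_pair_disjoint (G.ne_of_adj he) (G.ne_of_adj hf)
      (fun h => hv a ⟨.inl rfl, .inl h⟩) (fun h => hv a ⟨.inl rfl, .inr h⟩)
      (fun h => hv b ⟨.inr rfl, .inl h⟩) (fun h => hv b ⟨.inr rfl, .inr h⟩)]
    norm_num

theorem sum_signMean_sq_powersetCard_one :
    ∑ D ∈ G.edgeFinset.powersetCard 1, signMean D ^ 2 = (G.edgeFinset.card : ℝ) / 4 := by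
  rw [Finset.powersetCard_one, Finset.sum_map]
  have h : ∀ e ∈ G.edgeFinset, signMean ({e} : Finset (Sym2 V)) ^ 2 = 1 / 4 := by
    intro e he
    rw [SimpleGraph.mem_edgeFinset] at he
    induction e with | _ a b
    rw [signMean_singleton (G.ne_of_adj he)]
    norm_num
  simp only [Function.Embedding.coeFn_mk]
  rw [Finset.sum_congr rfl h]
  simp
  ring

/-- Double counting of pairs (vertex, two edges incident to it). -/
theorem sum_card_common_vertices :
    ∑ D ∈ G.edgeFinset.powersetCard 2,
        (Finset.univ.filter fun v => D ⊆ G.incidenceFinset v).card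
      = ∑ v : V, (G.degree v).choose 2 := by
  simp only [Finset.card_filter]
  rw [Finset.sum_comm]
  refine Finset.sum_congr rfl fun v _ => ?_
  rw [← Finset.card_filter, ← G.card_incidenceFinset_eq_degree, ← Finset.card_powersetCard]
  congr 1
  ext D
  simp only [Finset.mem_filter, Finset.mem_powersetCard]
  have := G.incidenceFinset_subset v
  exact ⟨fun h => ⟨h.2, h.1.2⟩, fun h => ⟨⟨h.1.trans this, h.2⟩, h.1⟩⟩

theorem sum_signMean_sq_powersetCard_two :
    ∑ D ∈ G.edgeFinset.powersetCard 2, signMean D ^ 2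
      = 1 / 16 * ((G.edgeFinset.card.choose 2 : ℝ) + 3 * ∑ v : V, ((G.degree v).choose 2 : ℝ)) := by
  rw [Finset.sum_congr rfl fun D hD => (signMean_sq_of_mem_powersetCard_two G hD).1,
    Finset.sum_add_distrib, ← Finset.mul_sum]
  have := sum_card_common_vertices G
  rify at this
  rw [this]
  simp
  ring

/-- Every pair of edges contributes at most `1/4`; monotonicity of the second-order overlap rests on
this bound. -/
theorem pair_coefficient_le :
    1 / 16 * ((G.edgeFinset.card.choose 2 : ℝ) + 3 * ∑ v : V, ((G.degree v).choose 2 : ℝ))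
      ≤ (G.edgeFinset.card.choose 2 : ℝ) / 4 := by
  rw [← sum_signMean_sq_powersetCard_two]
  refine (Finset.sum_le_sum fun D hD => (signMean_sq_of_mem_powersetCard_two G hD).2).trans ?_
  simp
  exact le_of_eq (by ring)

theorem overlapTrunc_two_eq (p : ℝ) :
    overlapTrunc G 2 p =
      p ^ G.edgeFinset.card
        + 1 / 4 * (1 - p) * p ^ (G.edgeFinset.card - 1) * (G.edgeFinset.card : ℝ)
        + 1 / 16 * (1 - p) ^ 2 * p ^ (G.edgeFinset.card - 2)
          * ((G.edgeFinset.card.choose 2 : ℝ) + 3 * ∑ v : V, ((G.degree v).choose 2 : ℝ)) := by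
  have hsplit : (G.edgeFinset.powerset.filter fun D => D.card ≤ 2)
      = (Finset.range 3).biUnion fun k => G.edgeFinset.powersetCard k := by
    ext D
    simp only [Finset.mem_filter, Finset.mem_powerset, Finset.mem_biUnion, Finset.mem_range,
      Finset.mem_powersetCard]
    exact ⟨fun h => ⟨D.card, by omega, h.1, rfl⟩, fun ⟨k, hk, h, h'⟩ => ⟨h, by omega⟩⟩
  have hlevel : ∀ k, ∑ D ∈ G.edgeFinset.powersetCard k,
      p ^ (G.edgeFinset.card - D.card) * (1 - p) ^ D.card * signMean D ^ 2
      = p ^ (G.edgeFinset.card - k) * (1 - p) ^ k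
        * ∑ D ∈ G.edgeFinset.powersetCard k, signMean D ^ 2 := by
    intro k
    rw [Finset.mul_sum]
    refine Finset.sum_congr rfl fun D hD => ?_
    rw [(Finset.mem_powersetCard.mp hD).2]
  rw [overlapTrunc_eq_sum, hsplit, Finset.sum_biUnion]
  · simp only [hlevel, Finset.sum_range_succ, Finset.range_zero, Finset.sum_empty,
      sum_signMean_sq_powersetCard_one, sum_signMean_sq_powersetCard_two,
      Finset.powersetCard_zero, Finset.sum_singleton, signMean_empty]
    simp only [Nat.sub_zero, pow_zero, pow_one]
    ring
  · intro i _ j _ hij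
    exact Finset.pairwise_disjoint_powersetCard _ hij

end Overlaps

end

end RandomizedGraph

namespace RandomizedGraph

open scoped Matrix ComplexOrder

noncomputable section

/-! ### Trace inequalities for positive semidefinite matrices -/

section PositiveMatrices

variable {ι : Type*} [Fintype ι]

theorem trace_mul_conjTranspose_mul_self_nonneg {A : Matrix ι ι ℂ} (hA : A.PosSemidef)
    (B : Matrix ι ι ℂ) : 0 ≤ Matrix.trace (A * (Bᴴ * B)) := by
  rw [← Matrix.mul_assoc, Matrix.trace_mul_comm, ← Matrix.mul_assoc]
  exact (hA.mul_mul_conjTranspose_same B).trace_nonneg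

/-- A multiple `P` of an orthogonal projection has expectation value at most its norm. -/
theorem trace_mul_le_of_mul_self [DecidableEq ι] {A P : Matrix ι ι ℂ} (hA : A.PosSemidef)
    (hP : P.IsHermitian) {c : ℝ} (hc : 0 < c) (hPP : P * P = (c : ℂ) • P) :
    Matrix.trace (A * P) ≤ (c : ℂ) * Matrix.trace A := by
  have hc' : (c : ℂ) ≠ 0 := by exact_mod_cast hc.ne'
  -- `M` is `c` times the complementary projection, so `Mᴴ * M = c • M` and `Tr (A * M) ≥ 0`.
  set M : Matrix ι ι ℂ := (c : ℂ) • 1 - P with hM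
  have hMh : Mᴴ = M := by
    rw [hM, Matrix.conjTranspose_sub, Matrix.conjTranspose_smul, hP.eq]
    simp
  have hsq : Mᴴ * M = (c : ℂ) • M := by
    rw [hMh, hM, Matrix.sub_mul, Matrix.mul_sub, Matrix.mul_sub, hPP]
    simp [smul_sub]
  have hnn : 0 ≤ (c : ℂ) * Matrix.trace (A * M) := by
    rw [← smul_eq_mul, ← Matrix.trace_smul, ← Matrix.mul_smul, ← hsq]
    exact trace_mul_conjTranspose_mul_self_nonneg hA M
  have hnn' : 0 ≤ Matrix.trace (A * M) := by
    have h := mul_nonneg (a := ((c⁻¹ : ℝ) : ℂ)) (by exact_mod_cast (inv_pos.mpr hc).le) hnn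
    rwa [← mul_assoc, Complex.ofReal_inv, inv_mul_cancel₀ hc', one_mul] at h
  rw [hM, Matrix.mul_sub, Matrix.trace_sub, Matrix.mul_smul, Matrix.mul_one, Matrix.trace_smul,
    smul_eq_mul] at hnn'
  exact sub_nonneg.mp hnn'

theorem trace_mul_ketBra (A : Matrix ι ι ℂ) (u : ι → ℂ) :
    Matrix.trace (A * ketBra u) = star u ⬝ᵥ A *ᵥ u := by
  rw [ketBra, Matrix.mul_vecMulVec, Matrix.trace_vecMulVec, dotProduct_comm]

theorem posSemidef_ketBra (u : ι → ℂ) : (ketBra u).PosSemidef :=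
  Matrix.posSemidef_vecMulVec_self_star u

theorem ketBra_mul_ketBra (u v : ι → ℂ) :
    ketBra u * ketBra v = (star u ⬝ᵥ v) • Matrix.vecMulVec u (star v) := by
  rw [ketBra, ketBra, Matrix.vecMulVec_mul_vecMulVec, Matrix.vecMulVec_smul]

/-- Bessel's inequality for two orthogonal vectors of equal length. -/
theorem dotProduct_mulVec_add_le [DecidableEq ι] {A : Matrix ι ι ℂ} (hA : A.PosSemidef)
    {u v : ι → ℂ} {c : ℝ} (hc : 0 < c) (hu : star u ⬝ᵥ u = c) (hv : star v ⬝ᵥ v = c)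
    (huv : star u ⬝ᵥ v = 0) :
    star u ⬝ᵥ A *ᵥ u + star v ⬝ᵥ A *ᵥ v ≤ (c : ℂ) * Matrix.trace A := by
  have hvu : star v ⬝ᵥ u = 0 := by
    rw [← star_star u, Matrix.star_dotProduct_star, huv, star_zero]
  rw [← trace_mul_ketBra, ← trace_mul_ketBra, ← Matrix.trace_add, ← Matrix.mul_add]
  refine trace_mul_le_of_mul_self hA
    ((posSemidef_ketBra u).isHermitian.add (posSemidef_ketBra v).isHermitian) hc ?_
  rw [Matrix.add_mul, Matrix.mul_add, Matrix.mul_add, ketBra_mul_ketBra, ketBra_mul_ketBra,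
    ketBra_mul_ketBra, ketBra_mul_ketBra, hu, hv, huv, hvu, smul_add]
  simp [ketBra]

/-- `ketBra z` is `‖z‖²` times a projection, so the expectation of `β` in `z` is at most `‖z‖² * Tr
β = ‖z‖²`. -/
theorem IsDensity.one_sub_posSemidef [DecidableEq ι] {β : Matrix ι ι ℂ} (hβ : IsDensity β) :
    (1 - β).PosSemidef := by
  refine Matrix.PosSemidef.of_dotProduct_mulVec_nonneg
    (Matrix.isHermitian_one.sub hβ.1.isHermitian) fun z => ?_
  rw [Matrix.sub_mulVec, Matrix.one_mulVec, dotProduct_sub, sub_nonneg]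
  by_cases hz : z = 0
  · simp [hz]
  have hpos : 0 < star z ⬝ᵥ z := Matrix.dotProduct_star_self_pos_iff.mpr hz
  obtain ⟨c, hc⟩ : ∃ c : ℝ, star z ⬝ᵥ z = c :=
    ⟨_, (Complex.eq_re_of_ofReal_le (r := 0) (by simp))⟩
  have hc0 : 0 < c := by
    rw [hc] at hpos
    exact_mod_cast hpos
  have h := trace_mul_le_of_mul_self hβ.1 (posSemidef_ketBra z).isHermitian hc0
    (by rw [ketBra_mul_ketBra, hc, ketBra])
  rwa [trace_mul_ketBra, hβ.2, mul_one, ← hc] at h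

end PositiveMatrices

/-! ### Fidelity of biseparable states with a graph state -/

section Bipartitions

variable {V : Type*} [Fintype V] [DecidableEq V]

theorem czSignReal_congr {e : Sym2 V} {x y : V → Fin 2} (h : ∀ v ∈ e, x v = y v) :
    czSignReal e x = czSignReal e y := by
  have : (∀ v ∈ e, x v = 1) ↔ ∀ v ∈ e, y v = 1 :=
    forall₂_congr fun v hv => by rw [h v hv]
  simp only [czSignReal, this]

theorem czSignReal_flipBit {e : Sym2 V} {a : V} (ha : a ∉ e) (x : V → Fin 2) :
    czSignReal e (flipBit a x) = czSignReal e x :=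
  czSignReal_congr fun v hv => by
    have hva : v ≠ a := fun h => ha (h ▸ hv)
    rw [flipBit, Function.update_of_ne hva]

theorem flipBit_comm {W : Type*} [DecidableEq W] {a b : W} (h : a ≠ b) (x : W → Fin 2) :
    flipBit a (flipBit b x) = flipBit b (flipBit a x) := by
  simp only [flipBit, Function.update_of_ne h, Function.update_of_ne h.symm]
  exact Function.update_comm h.symm _ _ _

/-- A multiplicative second difference in the bits at `a` and `b`: it is trivial unless the sign
depends on both, that is, unless `e` joins them. -/
theorem czSignReal_four_flips (e : Sym2 V) {a b : V} (hab : a ≠ b) (x : V → Fin 2) :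
    (czSignReal e x * czSignReal e (flipBit b x))
      * (czSignReal e (flipBit a x) * czSignReal e (flipBit b (flipBit a x)))
      = if e = s(a, b) then -1 else 1 := by
  by_cases ha : a ∈ e
  · by_cases hb : b ∈ e
    · have he : e = s(a, b) := (Sym2.mem_and_mem_iff hab).mp ⟨ha, hb⟩
      subst he
      simp only [czSignReal_mk, flipBit, if_true]
      generalize hi : x a = i
      generalize hj : x b = j
      fin_cases i <;> fin_cases j <;> simp [hi, hj, hab, hab.symm]
    · have hne : e ≠ s(a, b) := fun h => hb (h ▸ Sym2.mem_mk_right a b)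
      rw [czSignReal_flipBit hb, czSignReal_flipBit hb, if_neg hne, czSignReal_mul_self,
        czSignReal_mul_self, one_mul]
  · have hne : e ≠ s(a, b) := fun h => ha (h ▸ Sym2.mem_mk_left a b)
    rw [← flipBit_comm hab, czSignReal_flipBit ha, czSignReal_flipBit ha, if_neg hne,
      mul_mul_mul_comm, czSignReal_mul_self, czSignReal_mul_self, one_mul]

/-- The product of the signs of the graph state at two strings that differ at `b` changes sign
when the bit at a neighbour `a` of `b` is flipped. -/
theorem prod_czSignReal_flips {E : Finset (Sym2 V)} {a b : V} (hab : a ≠ b) (hE : s(a, b) ∈ E)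
    (x : V → Fin 2) :
    (∏ e ∈ E, czSignReal e (flipBit a x)) * (∏ e ∈ E, czSignReal e (flipBit b (flipBit a x)))
      = -((∏ e ∈ E, czSignReal e x) * ∏ e ∈ E, czSignReal e (flipBit b x)) := by
  have h : ((∏ e ∈ E, czSignReal e x) * ∏ e ∈ E, czSignReal e (flipBit b x))
      * ((∏ e ∈ E, czSignReal e (flipBit a x))
        * ∏ e ∈ E, czSignReal e (flipBit b (flipBit a x))) = -1 := by
    simp only [← Finset.prod_mul_distrib, czSignReal_four_flips _ hab]
    rw [Finset.prod_ite_eq' E s(a, b) fun _ => (-1 : ℝ), if_pos hE]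
  have h₁ := prod_czSignReal_mul_self E x
  have h₂ := prod_czSignReal_mul_self E (flipBit b x)
  set s := ∏ e ∈ E, czSignReal e x
  set t := ∏ e ∈ E, czSignReal e (flipBit b x)
  set u := (∏ e ∈ E, czSignReal e (flipBit a x))
        * ∏ e ∈ E, czSignReal e (flipBit b (flipBit a x))
  calc u = (s * s) * (t * t) * u := by rw [h₁, h₂]; ring
    _ = s * t * (s * t * u) := by ring
    _ = -(s * t) := by rw [h]; ring

/-- A bit string is a pair of bit strings on the two sides of a bipartition. -/
def splitBits {W : Type*} [DecidableEq W] (A : Finset W) :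
    (W → Fin 2) ≃ ({v // v ∈ A} → Fin 2) × ({v // v ∉ A} → Fin 2) :=
  Equiv.piEquivPiSubtypeProd (· ∈ A) fun _ => Fin 2

theorem splitBits_symm_flipBit_left {W : Type*} [DecidableEq W] (A : Finset W) (a : {v // v ∈ A}) (x : {v // v ∈ A} → Fin 2)
    (y : {v // v ∉ A} → Fin 2) :
    (splitBits A).symm (flipBit a x, y) = flipBit (a : W) ((splitBits A).symm (x, y)) := by
  funext w
  by_cases hw : w ∈ A
  · by_cases hwa : w = a
    · subst hwa
      simp [splitBits, flipBit]
    · have : (⟨w, hw⟩ : {v // v ∈ A}) ≠ a := fun h => hwa (by rw [← h])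
      simp [splitBits, flipBit, hw, hwa, this]
  · have hwa : w ≠ a := fun h => hw (h ▸ a.2)
    simp [splitBits, flipBit, hw, hwa]

theorem splitBits_symm_flipBit_right {W : Type*} [DecidableEq W] (A : Finset W) (b : {v // v ∉ A}) (x : {v // v ∈ A} → Fin 2)
    (y : {v // v ∉ A} → Fin 2) :
    (splitBits A).symm (x, flipBit b y) = flipBit (b : W) ((splitBits A).symm (x, y)) := by
  funext w
  by_cases hw : w ∈ A
  · have hwa : w ≠ b := fun h => b.2 (h ▸ hw)
    simp [splitBits, flipBit, hw, hwa]
  · by_cases hwa : w = b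
    · subst hwa
      simp [splitBits, flipBit, hw]
    · have : (⟨w, hw⟩ : {v // v ∉ A}) ≠ b := fun h => hwa (by rw [← h])
      simp [splitBits, flipBit, hw, hwa, this]

/-- The component of a vector at a fixed bit string outside `A`. -/
def slice (A : Finset V) (ψ : (V → Fin 2) → ℂ) (y : {v // v ∉ A} → Fin 2) :
    ({v // v ∈ A} → Fin 2) → ℂ :=
  fun x => ψ ((splitBits A).symm (x, y))

/-- The identity factor makes the quadratic form block diagonal in the bits outside `A`. -/
theorem dotProduct_kronecker_one (A : Finset V) (ψ : (V → Fin 2) → ℂ)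
    (α : Matrix ({v // v ∈ A} → Fin 2) ({v // v ∈ A} → Fin 2) ℂ) :
    star ψ ⬝ᵥ ((Matrix.kronecker α 1).submatrix (splitBits A) (splitBits A)) *ᵥ ψ
      = ∑ y, star (slice A ψ y) ⬝ᵥ α *ᵥ slice A ψ y := by
  simp only [dotProduct, Matrix.mulVec]
  rw [← Equiv.sum_comp (splitBits A).symm, Fintype.sum_prod_type, Finset.sum_comm]
  refine Finset.sum_congr rfl fun y _ => Finset.sum_congr rfl fun x _ => ?_
  rw [← Equiv.sum_comp (splitBits A).symm, Fintype.sum_prod_type]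
  congr 1
  refine Finset.sum_congr rfl fun x' _ => ?_
  simp [Matrix.kronecker, slice, Matrix.one_apply]

theorem slice_norm_sq (A : Finset V) (E : Finset (Sym2 V)) (y : {v // v ∉ A} → Fin 2) :
    star (slice A (graphState E) y) ⬝ᵥ slice A (graphState E) y
      = (((Fintype.card ({v // v ∈ A} → Fin 2) : ℝ) / 2 ^ Fintype.card V : ℝ) : ℂ) := by
  have h : ∀ x, star (slice A (graphState E) y) x * slice A (graphState E) y x
      = ((1 / 2 ^ Fintype.card V : ℝ) : ℂ) := by
    intro x
    have hs : star (slice A (graphState E) y) x = slice A (graphState E) y x :=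
      congrFun (star_graphState E) _
    rw [hs, slice, graphState_eq_ofReal, ← Complex.ofReal_mul, mul_mul_mul_comm,
      prod_czSignReal_mul_self, inv_sqrt_two_pow_mul_self, one_mul]
  rw [dotProduct, Finset.sum_congr rfl fun x _ => h x, Finset.sum_const, nsmul_eq_mul,
    Finset.card_univ]
  push_cast
  ring

/-- Flipping the bit at `a` permutes the summands and negates each of them, so the sum equals its
own negative. -/
theorem slice_orthogonal {A : Finset V} {E : Finset (Sym2 V)} {a b : V} (ha : a ∈ A) (hb : b ∉ A)
    (hE : s(a, b) ∈ E) (y : {v // v ∉ A} → Fin 2) :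
    star (slice A (graphState E) y) ⬝ᵥ slice A (graphState E) (flipBit ⟨b, hb⟩ y) = 0 := by
  have hab : a ≠ b := fun h => hb (h ▸ ha)
  set T : ({v // v ∈ A} → Fin 2) → ℂ := fun x =>
    star (slice A (graphState E) y) x * slice A (graphState E) (flipBit ⟨b, hb⟩ y) x with hT
  have hanti : ∀ x, T (flipBit ⟨a, ha⟩ x) = -T x := by
    intro x
    have hs : ∀ x, star (slice A (graphState E) y) x = slice A (graphState E) y x :=
      fun x => congrFun (star_graphState E) _
    simp only [hT, hs, slice, splitBits_symm_flipBit_left, splitBits_symm_flipBit_right,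
      graphState_eq_ofReal]
    rw [← Complex.ofReal_mul, ← Complex.ofReal_mul, ← Complex.ofReal_neg, mul_mul_mul_comm,
      mul_mul_mul_comm (∏ e ∈ E, czSignReal e ((splitBits A).symm (x, y))),
      prod_czSignReal_flips hab hE, neg_mul]
  have h : ∑ x, T x = -∑ x, T x := by
    rw [← Finset.sum_neg_distrib, ← sum_flipBit ⟨a, ha⟩ T]
    exact Finset.sum_congr rfl fun x _ => hanti x
  exact self_eq_neg.mp h

/-- A state that is a product across a bipartition cut by an edge has fidelity at most `1/2` with
the graph state. -/
theorem trace_ketBra_mul_le_of_isProductAcross {A : Finset V} {E : Finset (Sym2 V)} {a b : V}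
    (ha : a ∈ A) (hb : b ∉ A) (hE : s(a, b) ∈ E) {σ : Matrix (V → Fin 2) (V → Fin 2) ℂ}
    (hσ : IsProductAcross A σ) :
    (Matrix.trace (ketBra (graphState E) * σ)).re ≤ 1 / 2 := by
  obtain ⟨α, β, hα, hβ, hprod⟩ := hσ
  set ψ := graphState E with hψ
  set τ : Matrix (V → Fin 2) (V → Fin 2) ℂ :=
    (Matrix.kronecker α 1).submatrix (splitBits A) (splitBits A) with hτ
  -- The difference is `α ⊗ (1 - β)`, a Kronecker product of positive semidefinite matrices.
  have hpsd : (τ - σ).PosSemidef := by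
    have h := (hα.1.kronecker hβ.one_sub_posSemidef).submatrix (splitBits A)
    have heq : τ - σ = (Matrix.kroneckerMap (· * ·) α (1 - β)).submatrix
        (splitBits A) (splitBits A) := by
      ext x y
      simp only [hτ, Matrix.sub_apply, Matrix.submatrix_apply, Matrix.kronecker,
        Matrix.kroneckerMap_apply, hprod x y, mul_sub]
      rfl
    rw [heq]
    exact h
  have hle : (star ψ ⬝ᵥ σ *ᵥ ψ).re ≤ (star ψ ⬝ᵥ τ *ᵥ ψ).re := by
    have h := (Complex.le_def.mp (hpsd.dotProduct_mulVec_nonneg ψ)).1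
    rw [Matrix.sub_mulVec, dotProduct_sub, Complex.sub_re, Complex.zero_re] at h
    linarith
  rw [Matrix.trace_mul_comm, trace_mul_ketBra]
  refine hle.trans ?_
  rw [hτ, dotProduct_kronecker_one, Complex.re_sum]
  set Q : ({v // v ∉ A} → Fin 2) → ℝ := fun y =>
    (star (slice A ψ y) ⬝ᵥ α *ᵥ slice A ψ y).re with hQ
  set c : ℝ := (Fintype.card ({v // v ∈ A} → Fin 2) : ℝ) / 2 ^ Fintype.card V with hc
  have hc0 : 0 < c := by
    have : 0 < Fintype.card ({v // v ∈ A} → Fin 2) := Fintype.card_pos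
    positivity
  have hpair : ∀ y, Q y + Q (flipBit ⟨b, hb⟩ y) ≤ c := by
    intro y
    have h := dotProduct_mulVec_add_le hα.1 hc0 (slice_norm_sq A E y) (slice_norm_sq A E _)
      (slice_orthogonal ha hb hE y)
    rw [hα.2, mul_one] at h
    exact (Complex.le_def.mp h).1
  have htotal : (Fintype.card ({v // v ∉ A} → Fin 2) : ℝ) * c = 1 := by
    have h := Fintype.card_congr (splitBits A)
    rw [Fintype.card_prod, Fintype.card_fun, Fintype.card_fin] at h
    rw [hc, mul_div_assoc', mul_comm, div_eq_one_iff_eq (by positivity)]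
    exact_mod_cast h.symm
  -- Summing over all `y` counts every `Q y` twice, while the right side totals `1`; this is the
  -- source of `1/2`.
  have hsum := Finset.sum_le_sum fun y (_ : y ∈ Finset.univ) => hpair y
  rw [Finset.sum_add_distrib, sum_flipBit, Finset.sum_const, nsmul_eq_mul, Finset.card_univ,
    htotal] at hsum
  linarith

theorem convex_fidelity_le (E : Finset (Sym2 V)) (c : ℝ) :
    Convex ℝ {σ : Matrix (V → Fin 2) (V → Fin 2) ℂ |
      (Matrix.trace (ketBra (graphState E) * σ)).re ≤ c} := by
  refine convex_halfSpace_le (𝕜 := ℝ) ⟨fun σ τ => ?_, fun r σ => ?_⟩ c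
  · rw [Matrix.mul_add, Matrix.trace_add, Complex.add_re]
  · rw [Matrix.mul_smul, Matrix.trace_smul, Complex.real_smul, Complex.re_ofReal_mul,
      smul_eq_mul]

variable (G : SimpleGraph V) [DecidableRel G.Adj]

theorem exists_edge_across {G : SimpleGraph V} (hG : G.Connected) {A : Finset V}
    (hA : A.Nonempty) (hA' : Aᶜ.Nonempty) : ∃ a ∈ A, ∃ b, b ∉ A ∧ G.Adj a b := by
  obtain ⟨u, hu⟩ := hA
  obtain ⟨w, hw⟩ := hA'
  obtain ⟨p⟩ := hG.preconnected u w
  obtain ⟨d, _, h₁, h₂⟩ := p.exists_boundary_dart (A : Set V) hu (by simpa using hw)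
  exact ⟨d.fst, h₁, d.snd, h₂, d.adj⟩

theorem isDensity_rgState {p : ℝ} (hp : p ∈ Set.Icc (0 : ℝ) 1) : IsDensity (rgState G p) := by
  refine ⟨Matrix.posSemidef_sum _ fun F _ => ?_, ?_⟩
  · have h₁ := hp.1
    have h₂ : 0 ≤ 1 - p := sub_nonneg.mpr hp.2
    exact (posSemidef_ketBra _).smul (by positivity)
  · rw [rgState, Matrix.trace_sum]
    simp only [Matrix.trace_smul, trace_ketBra_graphState_self]
    rw [← Finset.sum_smul]
    have h : ∑ F ∈ G.edgeFinset.powerset, p ^ F.card * (1 - p) ^ (G.edgeFinset \ F).card = 1 := by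
      have h := Finset.sum_pow_mul_eq_add_pow p (1 - p) G.edgeFinset
      rw [add_sub_cancel, one_pow] at h
      refine (Finset.sum_congr rfl fun F hF => ?_).trans h
      rw [Finset.card_sdiff_of_subset (Finset.mem_powerset.mp hF)]
    rw [h, one_smul]

theorem witnessValue_eq {p : ℝ} (hp : p ∈ Set.Icc (0 : ℝ) 1) :
    witnessValue G p = 1 / 2 - overlap G p := by
  rw [witnessValue, projWitness, Matrix.sub_mul, Matrix.trace_sub, Complex.sub_re, overlap,
    Matrix.smul_mul, Matrix.one_mul, Matrix.trace_smul, (isDensity_rgState G hp).2]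
  simp

/-- The projector-based witness of a connected graph detects genuine multipartite entanglement. -/
theorem isGME_of_half_lt_overlap {G : SimpleGraph V} [DecidableRel G.Adj] (hG : G.Connected)
    {p : ℝ} (hp : p ∈ Set.Icc (0 : ℝ) 1) (h : 1 / 2 < overlap G p) : IsGME (rgState G p) := by
  refine ⟨isDensity_rgState G hp, fun hmem => h.not_ge ?_⟩
  -- The fidelity bound defines a convex set, so it passes through both hulls: over bipartitions
  -- here, then over product states for each one.
  refine convexHull_min ?_ (convex_fidelity_le G.edgeFinset (1 / 2)) hmem
  rintro σ ⟨A, hA, hA', hσ⟩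
  obtain ⟨a, ha, b, hb, hab⟩ := exists_edge_across hG hA hA'
  refine convexHull_min (fun τ hτ => ?_) (convex_fidelity_le G.edgeFinset (1 / 2)) hσ
  exact trace_ketBra_mul_le_of_isProductAcross ha hb (by simpa using hab) hτ

end Bipartitions

end

end RandomizedGraph

namespace RandomizedGraph

noncomputable section

/-! ### Monotonicity and the unique crossing of the second-order overlap -/

section TruncatedWitness

/-- The overlap up to second order is strictly increasing if the second-order coefficient is at
most `m (m - 1) / 8`. -/
theorem strictMonoOn_secondOrder {m : ℕ} (hm : m ≠ 0) {C : ℝ} (hC : 0 ≤ C)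
    (hC' : C ≤ (m.choose 2 : ℝ) / 4) :
    StrictMonoOn (fun p : ℝ => p ^ m + 1 / 4 * (1 - p) * p ^ (m - 1) * m
      + C * (1 - p) ^ 2 * p ^ (m - 2)) (Set.Icc 0 1) := by
  -- For `m = 1` the exponent `m - 2` truncates to `0`, but then `1.choose 2 = 0` forces `C = 0`.
  obtain rfl | ⟨k, rfl⟩ : m = 1 ∨ ∃ k, m = k + 2 := by
    rcases m with _ | _ | k
    · exact absurd rfl hm
    · exact .inl rfl
    · exact .inr ⟨k, rfl⟩
  · have hC0 : C = 0 := le_antisymm (by simpa using hC') hC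
    intro p _ q _ hpq
    simp only [hC0]
    norm_num
    linarith
  · have hC2 : C ≤ ((k : ℝ) + 2) * (k + 1) / 8 := by
      rw [Nat.cast_choose_two] at hC'
      push_cast at hC'
      linarith
    simp only [Nat.add_sub_cancel, show k + 2 - 1 = k + 1 from rfl]
    refine strictMonoOn_of_deriv_pos (convex_Icc 0 1) (by fun_prop) fun p hp => ?_
    rw [interior_Icc] at hp
    have hp0 := hp.1
    have hq : 0 < 1 - p := sub_pos.mpr hp.2
    -- The derivative is grouped so that each summand is nonnegative: the only negative part, from
    -- `(1 - p) ^ 2`, is absorbed by the linear term through `hC2`. At `k = 0` the factor `k` kills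
    -- the truncated power.
    have hd : HasDerivAt (fun p : ℝ => p ^ (k + 2) + 1 / 4 * (1 - p) * p ^ (k + 1) * (k + 2 : ℕ)
        + C * (1 - p) ^ 2 * p ^ k)
        (3 / 4 * (k + 2) * p ^ (k + 1)
          + (1 - p) * p ^ k * (2 * (((k : ℝ) + 2) * (k + 1) / 8 - C))
          + C * (1 - p) ^ 2 * (k * p ^ (k - 1))) p := by
      have hid : HasDerivAt (fun p : ℝ => 1 - p) (-1) p := by
        simpa using (hasDerivAt_id p).const_sub 1
      have h₁ := hasDerivAt_pow (k + 2) p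
      have h₂ := ((hid.const_mul (1 / 4)).mul (hasDerivAt_pow (k + 1) p)).mul_const
        ((k + 2 : ℕ) : ℝ)
      have h₃ := ((hid.pow 2).const_mul C).mul (hasDerivAt_pow k p)
      refine ((h₁.add h₂).add h₃).congr_deriv ?_
      simp only [Nat.add_sub_cancel, show k + 2 - 1 = k + 1 from rfl, Pi.pow_apply]
      push_cast
      ring
    rw [hd.deriv]
    have h₁ : 0 < 3 / 4 * ((k : ℝ) + 2) * p ^ (k + 1) := by positivity
    have h₂ : 0 ≤ (1 - p) * p ^ k * (2 * (((k : ℝ) + 2) * (k + 1) / 8 - C)) :=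
      mul_nonneg (by positivity) (by linarith)
    have h₃ : 0 ≤ C * (1 - p) ^ 2 * (k * p ^ (k - 1)) := by positivity
    linarith

variable {V : Type*} [Fintype V] [DecidableEq V] (G : SimpleGraph V) [DecidableRel G.Adj]

theorem overlapTrunc_two_eq_secondOrder :
    overlapTrunc G 2 = fun p : ℝ => p ^ G.edgeFinset.card
      + 1 / 4 * (1 - p) * p ^ (G.edgeFinset.card - 1) * (G.edgeFinset.card : ℝ)
      + 1 / 16 * ((G.edgeFinset.card.choose 2 : ℝ) + 3 * ∑ v : V, ((G.degree v).choose 2 : ℝ))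
        * (1 - p) ^ 2 * p ^ (G.edgeFinset.card - 2) := by
  funext p
  rw [overlapTrunc_two_eq]
  ring

theorem strictMonoOn_overlapTrunc_two (hE : G.edgeFinset.Nonempty) :
    StrictMonoOn (overlapTrunc G 2) (Set.Icc 0 1) := by
  rw [overlapTrunc_two_eq_secondOrder]
  exact strictMonoOn_secondOrder hE.card_ne_zero (by positivity) (pair_coefficient_le G)

/-- At `p = 0` only removing every edge contributes, which the truncation permits just for `m ≤ 2`;
the cases `m = 1, 2` use `0 ^ 0 = 1`. -/
theorem overlapTrunc_two_zero_le (hE : G.edgeFinset.Nonempty) : overlapTrunc G 2 0 ≤ 1 / 4 := by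
  have hC := pair_coefficient_le G
  have hm := hE.card_ne_zero
  rw [overlapTrunc_two_eq_secondOrder]
  generalize G.edgeFinset.card = m at hC hm ⊢
  rcases m with _ | _ | _ | k
  · exact absurd rfl hm
  · norm_num at hC ⊢
    linarith
  · norm_num at hC ⊢
    linarith
  · simp

theorem overlapTrunc_two_one : overlapTrunc G 2 1 = 1 := by
  rw [overlapTrunc_two_eq]
  simp

theorem exists_overlapTrunc_two_eq_half (hE : G.edgeFinset.Nonempty) :
    ∃ q ∈ Set.Icc (0 : ℝ) 1, overlapTrunc G 2 q = 1 / 2 := by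
  have hcont : ContinuousOn (overlapTrunc G 2) (Set.Icc 0 1) := by
    rw [overlapTrunc_two_eq_secondOrder]
    fun_prop
  refine intermediate_value_Icc zero_le_one hcont ⟨?_, ?_⟩
  · linarith [overlapTrunc_two_zero_le G hE]
  · rw [overlapTrunc_two_one]
    norm_num

end TruncatedWitness

/-! ### Comparison of thresholds -/

section Thresholds

theorem threshold_le {P : ℝ → Prop} {t : ℝ} (ht : t ∈ Set.Icc (0 : ℝ) 1)
    (h : ∀ p ∈ Set.Ioc t 1, P p) : threshold P ≤ t :=
  csInf_le ⟨0, fun _ hs => hs.1.1⟩ ⟨ht, h⟩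

theorem threshold_anti {P Q : ℝ → Prop} (h : ∀ p ∈ Set.Icc (0 : ℝ) 1, P p → Q p) :
    threshold Q ≤ threshold P := by
  -- `t = 1` is always admissible because `(1, 1]` is empty, so the infimum is over a nonempty set.
  refine le_csInf ⟨1, ⟨zero_le_one, le_rfl⟩, fun p hp => absurd hp.1 hp.2.not_gt⟩ ?_
  rintro t ⟨ht, hP⟩
  exact threshold_le ht fun p hp => h p ⟨ht.1.trans hp.1.le, hp.2⟩ (hP p hp)

end Thresholds

end

end RandomizedGraph

open RandomizedGraph in
theorem mainTheorem4 {V : Type*} [Fintype V] [DecidableEq V]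
    (G : SimpleGraph V) [DecidableRel G.Adj] :
    -- the lower bound and its closed form
    (∀ p ∈ Set.Icc (0 : ℝ) 1,
      overlapTrunc G 2 p ≤ overlap G p ∧
      overlapTrunc G 2 p =
        p ^ G.edgeFinset.card
          + 1 / 4 * (1 - p) * p ^ (G.edgeFinset.card - 1) * (G.edgeFinset.card : ℝ)
          + 1 / 16 * (1 - p) ^ 2 * p ^ (G.edgeFinset.card - 2)
            * ((G.edgeFinset.card.choose 2 : ℝ) + 3 * ∑ v : V, ((G.degree v).choose 2 : ℝ)) ∧
      witnessValue G p ≤ witnessTrunc G 2 p) ∧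
    -- the quality of the approximation for `p` close to `1`
    (fun p => overlap G p - overlapTrunc G 2 p)
      =O[nhdsWithin 1 (Set.Icc (0 : ℝ) 1)] (fun p => (1 - p) ^ 3) ∧
    -- detection of genuine multipartite entanglement
    (G.Connected → ∀ p ∈ Set.Icc (0 : ℝ) 1, witnessTrunc G 2 p < 0 → IsGME (rgState G p)) ∧
    -- the threshold of the approximated witness
    (G.edgeFinset.Nonempty →
      ∃ pF ∈ Set.Icc (0 : ℝ) 1,
        (∀ q ∈ Set.Icc (0 : ℝ) 1, witnessTrunc G 2 q = 0 ↔ q = pF) ∧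
        (∀ p ∈ Set.Ioc pF 1, witnessTrunc G 2 p < 0) ∧
        witnessP G ≤ pF ∧
        (∀ q ∈ Set.Icc (0 : ℝ) 1, witnessValue G q = 0 → q ≤ pF) ∧
        (G.Connected →
          criticalP G ≤ witnessP G ∧ ∀ p ∈ Set.Ioc pF 1, IsGME (rgState G p))) := by
  have hwit : ∀ p ∈ Set.Icc (0 : ℝ) 1, witnessValue G p ≤ witnessTrunc G 2 p := by
    intro p hp
    rw [witnessValue_eq G hp, witnessTrunc]
    linarith [overlapTrunc_le_overlap G 2 hp]
  have hgme : G.Connected → ∀ p ∈ Set.Icc (0 : ℝ) 1, witnessValue G p < 0 →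
      IsGME (rgState G p) := by
    intro hG p hp h
    rw [witnessValue_eq G hp] at h
    exact isGME_of_half_lt_overlap hG hp (by linarith)
  refine ⟨fun p hp => ⟨overlapTrunc_le_overlap G 2 hp, overlapTrunc_two_eq G p, hwit p hp⟩,
    overlap_sub_overlapTrunc_isBigO G 2,
    fun hG p hp h => hgme hG p hp ((hwit p hp).trans_lt h), fun hE => ?_⟩
  obtain ⟨pF, hpF, hhalf⟩ := exists_overlapTrunc_two_eq_half G hE
  have hmono := strictMonoOn_overlapTrunc_two G hE
  have hIcc : ∀ p ∈ Set.Ioc pF 1, p ∈ Set.Icc (0 : ℝ) 1 :=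
    fun p hp => ⟨hpF.1.trans hp.1.le, hp.2⟩
  have hneg : ∀ p ∈ Set.Ioc pF 1, witnessTrunc G 2 p < 0 := by
    intro p hp
    have := hmono hpF (hIcc p hp) hp.1
    rw [witnessTrunc]
    linarith
  have hneg' : ∀ p ∈ Set.Ioc pF 1, witnessValue G p < 0 :=
    fun p hp => (hwit p (hIcc p hp)).trans_lt (hneg p hp)
  refine ⟨pF, hpF, fun q hq => ⟨fun h => ?_, fun h => ?_⟩, hneg, threshold_le hpF hneg',
    fun q hq h => ?_, fun hG => ⟨threshold_anti (hgme hG), fun p hp =>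
      hgme hG p (hIcc p hp) (hneg' p hp)⟩⟩
  · refine hmono.injOn hq hpF ?_
    rw [witnessTrunc] at h
    linarith
  · rw [h, witnessTrunc, hhalf, sub_self]
  · by_contra! hlt
    exact (hneg' q ⟨hlt, hq.2⟩).ne h
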